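/- **Theorem 4.3 (Statistical bounds for refutation).** For $k\ge 2$ and a graph $G$ on $n\ge k$ vertices let $\mathsf{val}_k(G)$ be the densest-$k$-subgraph value, i.e. the maximum over all $k$-element vertex sets $S$ of $e_G(S)/\binom{k}{2}$, where $e_G(S)$ is the number of edges of $G$ with both endpoints in $S$. Let $D_{KL}(p\|q)$ be the Kullback–Leibler divergence between the Bernoulli laws with parameters $p$ and $q$. For nonnegative sequences $f,g$ write $f\in\tilde\omega(g)$ if $f=\omega(g\log^c n)$ for every real constant $c$, $f\in\tilde o(g)$ if $f=o(g\log^{c} n)$ for every real constant $c$, and $f\in\tilde\Theta(g)$ if $f=O(g\log^{c}n)$ and $f=\Omega(g\log^{c'}n)$ for some real constants $c,c'$ (possibly negative). Let $\gamma\in(1/2,1)$, let $k=k_n$ be natural numbers with $k_n\in\tilde\Theta(n^\gamma)$, let $p_0=p_{0,n}\in[0,1]$ be bounded away from $0$ and $1$ (for some $\varepsilon>0$, $\varepsilon\le p_{0,n}\le 1-\varepsilon$ for all large $n$), and let $p=p_n\in[0,1]$. Let $G_n\sim G(n,p_{0,n})$ be the Erdős–Rényi random graph. Then: 1. If $p_n\ge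 p_{0,n}$ for all large $n$ and $k_n D_{KL}(p_n\|p_{0,n})\in\tilde\omega(1)$, then $\mathbb P\big(\mathsf{val}_{k_n}(G_n)\le p_n\big)\to1$ as $n\to\infty$. 2. If $k_n D_{KL}(p_n\|p_{0,n})\in\tilde o(1)$, then $\mathbb P\big(\mathsf{val}_{k_n}(G_n)\ge p_n\big)\to1$ as $n\to\infty$. -/

import Mathlib

open Filter Topology Asymptotics MeasureTheory ProbabilityTheory

/-- Edge density of the subgraph of `G` induced on `S`: the number of edges of `G` with both
endpoints in `S`, divided by the number of pairs of vertices of `S`. -/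
noncomputable def subgraphDensity {V : Type*} (G : SimpleGraph V) (S : Finset V) : ℝ :=
  ((G.induce (S : Set V)).edgeSet.ncard : ℝ) / (S.card.choose 2 : ℝ)

/-- The densest-`k`-subgraph value `val(G)`: the largest edge density of a subgraph of `G` induced
on exactly `k` vertices. -/
noncomputable def densestSubgraphVal {V : Type*} [Fintype V] (k : ℕ) (G : SimpleGraph V) : ℝ :=
  ⨆ S : {S : Finset V // S.card = k}, subgraphDensity G S.1

/-- The Kullback–Leibler divergence `D_KL(p ‖ q)` between the Bernoulli laws of parameters `p`
and `q` (finite whenever `0 < q < 1`). -/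
noncomputable def bernoulliKL (p q : unitInterval) : ℝ :=
  (InformationTheory.klDiv (bernoulliMeasure true false p) (bernoulliMeasure true false q)).toReal

/-- `f ∈ Õ(g)`: `f = O(g · log^c n)` for some constant `c`. -/
def IsTildeO (f g : ℕ → ℝ) : Prop :=
  ∃ c : ℝ, f =O[atTop] fun n => g n * Real.log n ^ c

/-- `f ∈ Ω̃(g)`: `f = Ω(g · log^c n)` for some constant `c` (possibly negative). -/
def IsTildeBigOmega (f g : ℕ → ℝ) : Prop :=
  ∃ c : ℝ, (fun n => g n * Real.log n ^ c) =O[atTop] f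

/-- `f ∈ Θ̃(g)`. -/
def IsTildeTheta (f g : ℕ → ℝ) : Prop :=
  IsTildeO f g ∧ IsTildeBigOmega f g

/-- `f ∈ õ(g)`: `f = o(g · log^c n)` for every constant `c` (in particular negative ones). -/
def IsTildeLittleO (f g : ℕ → ℝ) : Prop :=
  ∀ c : ℝ, f =o[atTop] fun n => g n * Real.log n ^ c

/-- `f ∈ ω̃(g)`: `f = ω(g · log^c n)` for every constant `c`. -/
def IsTildeLittleOmega (f g : ℕ → ℝ) : Prop :=
  ∀ c : ℝ, (fun n => g n * Real.log n ^ c) =o[atTop] f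

/-!
Only two features of the hypotheses matter: `k → ∞` with `k = o(n)`, and the size of `k · KL`
compared with `log n` (for the upper bound) and with a constant (for the lower bound).

*Upper bound.* By Chernoff's inequality a fixed set of `k` vertices has density at least `p` with
probability at most `exp (-(k.choose 2) · KL)` (`edgeCount_chernoff`). There are at most `n ^ k` such
sets, and `k · KL ≥ 8 log n` makes the union bound (`measure_lt_densestSubgraphVal_le`) vanish.

*Lower bound.* By a weak Pinsker inequality, `(p - p₀)² ≤ 4 KL`, it suffices to find `k` vertices
spanning `c k ^ (3/2)` more edges than the mean, for a constant `c > 0` depending only on the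
distance from `p₀` to `0` and `1`. Fix a set `A` of `k / 2` vertices, and from each of `k - k / 2`
disjoint pairs of other vertices take the one with more neighbours in `A`. The degrees into `A`
of the two vertices of a pair differ by order `√k` on average, by a second and fourth moment
estimate (`sqrt_card_le_integral_abs_sum`), and distinct pairs behave independently, so the edges
between `A` and the chosen vertices exceed their mean by order `k ^ (3/2)`. The edges inside `A` and
between chosen vertices are independent of the choices and deviate by order `k` only. All this is
`exists_selection`, a statement about independent variables; `measure_densestSubgraphVal_lt_le`
translates it to graphs.
-/

/-! ### Edge indicators in the binomial random graph -/

instance {V : Type*} [Finite V] : DiscreteMeasurableSpace (SimpleGraph V) := by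
  have : MeasurableSingletonClass (SimpleGraph V) := by
    refine ⟨fun G => ?_⟩
    have h : ({G} : Set (SimpleGraph V)) = SimpleGraph.edgeSet ⁻¹' {G.edgeSet} := by
      ext H; simp
    rw [h]
    exact SimpleGraph.measurable_edgeSet (measurableSet_singleton _)
  infer_instance

/-- The indicator, with values in `ℝ`, of the presence of the pair `e` among the edges of `G`. It is
`0` for diagonal pairs. -/
noncomputable def edgeIndicator {V : Type*} (e : Sym2 V) (G : SimpleGraph V) : ℝ :=
  G.edgeSet.indicator (fun _ => 1) e

lemma edgeIndicator_eq_zero_or_one {V : Type*} (e : Sym2 V) (G : SimpleGraph V) :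
    edgeIndicator e G = 0 ∨ edgeIndicator e G = 1 := by
  unfold edgeIndicator Set.indicator
  split_ifs <;> simp

lemma edgeIndicator_nonneg {V : Type*} (e : Sym2 V) (G : SimpleGraph V) :
    0 ≤ edgeIndicator e G := by
  rcases edgeIndicator_eq_zero_or_one e G with h | h <;> simp [h]

lemma edgeIndicator_le_one {V : Type*} (e : Sym2 V) (G : SimpleGraph V) :
    edgeIndicator e G ≤ 1 := by
  rcases edgeIndicator_eq_zero_or_one e G with h | h <;> simp [h]

lemma measurable_edgeIndicator {V : Type*} (e : Sym2 V) : Measurable (edgeIndicator e) := by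
  have h : MeasurableSet {G : SimpleGraph V | e ∈ G.edgeSet} := by
    have := SimpleGraph.measurable_edgeSet (V := V)
    exact measurableSet_setOfPred.2 (measurable_set_iff.1 this e)
  exact (measurable_const (a := (1 : ℝ))).indicator h

/-- Under `G(V, p)` the edge indicators are independent Bernoulli variables of parameter `p`. (Those
of diagonal pairs are identically zero, which leaves independence intact.) -/
lemma edgeIndicator_iIndepFun_and_integral {V : Type*} [Countable V] (p : unitInterval) :
    iIndepFun (fun e : Sym2 V => edgeIndicator e) (SimpleGraph.binomialRandom V p) ∧
    ∀ e : Sym2 V, ¬ e.IsDiag → ∀ F : ℝ → ℝ,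
      ∫ G, F (edgeIndicator e G) ∂(SimpleGraph.binomialRandom V p) = p * F 1 + (1 - p) * F 0 := by
  classical
  let ν : Sym2 V → Measure Prop := fun e =>
    bernoulliMeasure (e ∈ (Sym2.diagSetᶜ : Set (Sym2 V))) False p
  let X : Sym2 V → Prop → ℝ := fun e q => if q ∧ ¬ e.IsDiag then 1 else 0
  let T : (Sym2 V → Prop) → SimpleGraph V := fun ω => SimpleGraph.fromEdgeSet {e | ω e}
  have hT : Measurable T :=
    SimpleGraph.measurable_fromEdgeSet.comp (measurable_set_iff.2 fun e => measurable_pi_apply e)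
  have hmap : SimpleGraph.binomialRandom V p = (Measure.infinitePi ν).map T := by
    have hm : Measurable fun q : Sym2 V → Prop => {e | q e} :=
      measurable_set_iff.2 fun e => measurable_pi_apply e
    rw [SimpleGraph.binomialRandom_eq_map, setBernoulli_eq_map]
    exact Measure.map_map SimpleGraph.measurable_fromEdgeSet hm
  have hX : ∀ e ω, edgeIndicator e (T ω) = X e (ω e) := by
    intro e ω
    simp only [edgeIndicator, T, X, SimpleGraph.edgeSet_fromEdgeSet, Set.indicator]
    congr 1
  have hXm : ∀ e, Measurable (X e) := fun e => Measurable.of_discrete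
  constructor
  · rw [hmap, iIndepFun_iff_measure_inter_preimage_eq_mul]
    have := iIndepFun_infinitePi (P := ν) (X := X) hXm
    rw [iIndepFun_iff_measure_inter_preimage_eq_mul] at this
    intro S sets hs
    have h := this S hs
    rw [Measure.map_apply hT
      (S.measurableSet_biInter fun i hi => measurable_edgeIndicator i (hs i hi))]
    rw [Finset.prod_congr rfl fun i hi => Measure.map_apply hT (measurable_edgeIndicator i (hs i hi))]
    simp only [Set.preimage_iInter, ← Set.preimage_comp]
    have e : ∀ i, edgeIndicator i ∘ T = fun ω => X i (ω i) := fun i => funext (hX i)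
    simpa only [e] using h
  · intro e he F
    have h2 : (SimpleGraph.binomialRandom V p).map (edgeIndicator e) = (ν e).map (X e) := by
      rw [hmap, Measure.map_map (measurable_edgeIndicator e) hT]
      have : edgeIndicator e ∘ T = X e ∘ (fun ω => ω e) := funext (hX e)
      rw [this, ← Measure.map_map (hXm e) (measurable_pi_apply e), Measure.infinitePi_map_eval]
    have h3 : (ν e).map (X e) = bernoulliMeasure 1 0 p := by
      simp only [ν]
      rw [map_bernoulliMeasure]
      simp [X, he]
    rw [h3] at h2
    have hF : AEStronglyMeasurable F
        ((SimpleGraph.binomialRandom V p).map (edgeIndicator e)) := by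
      rw [h2]
      exact (integrable_bernoulliMeasure _ _ _ F).aestronglyMeasurable
    rw [← integral_map (measurable_edgeIndicator e).aemeasurable hF, h2,
      integral_bernoulliMeasure]
    simp

open Classical in
/-- The pairs of distinct elements of `S`, i.e. the potential edges inside `S`. -/
noncomputable def edgesWithin {V : Type*} (S : Finset V) : Finset (Sym2 V) :=
  S.offDiag.image Sym2.mk.uncurry

lemma mk_mem_edgesWithin {V : Type*} {S : Finset V} {u v : V} :
    s(u, v) ∈ edgesWithin S ↔ u ∈ S ∧ v ∈ S ∧ u ≠ v := by
  classical
  simp only [edgesWithin, Finset.mem_image, Finset.mem_offDiag, Prod.exists]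
  constructor
  · rintro ⟨a, b, h, e⟩
    rcases Sym2.eq_iff.1 e with ⟨rfl, rfl⟩ | ⟨rfl, rfl⟩
    · exact h
    · exact ⟨h.2.1, h.1, h.2.2.symm⟩
  · exact fun h => ⟨u, v, h, rfl⟩

lemma card_edgesWithin {V : Type*} (S : Finset V) :
    (edgesWithin S).card = S.card.choose 2 := by
  classical
  rw [edgesWithin, ← Sym2.card_image_offDiag S]

lemma not_isDiag_of_mem_edgesWithin {V : Type*} {S : Finset V} {e : Sym2 V}
    (he : e ∈ edgesWithin S) : ¬ e.IsDiag := by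
  induction e using Sym2.ind with
  | _ u v => exact (mk_mem_edgesWithin.1 he).2.2

lemma ncard_edgeSet_induce {V : Type*} (G : SimpleGraph V) (S : Finset V) :
    ((G.induce (S : Set V)).edgeSet.ncard : ℝ) = ∑ e ∈ edgesWithin S, edgeIndicator e G := by
  classical
  have h : Sym2.map Subtype.val '' (G.induce (S : Set V)).edgeSet
      = ((edgesWithin S).filter (· ∈ G.edgeSet) : Finset (Sym2 V)) := by
    ext e
    induction e using Sym2.ind with
    | _ u v =>
      simp only [Set.mem_image, Finset.coe_filter, Set.mem_ofPred_eq, mk_mem_edgesWithin,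
        SimpleGraph.mem_edgeSet]
      constructor
      · rintro ⟨e, he, h⟩
        induction e using Sym2.ind with
        | _ a b =>
          rw [Sym2.map_mk, Sym2.eq_iff] at h
          rw [SimpleGraph.mem_edgeSet, SimpleGraph.induce_adj] at he
          rcases h with ⟨rfl, rfl⟩ | ⟨rfl, rfl⟩
          · exact ⟨⟨a.2, b.2, he.ne⟩, he⟩
          · exact ⟨⟨b.2, a.2, he.ne.symm⟩, he.symm⟩
      · rintro ⟨⟨hu, hv, -⟩, h⟩
        exact ⟨s(⟨u, hu⟩, ⟨v, hv⟩), by simpa using h, rfl⟩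
  rw [← Set.ncard_image_of_injective _ (Sym2.map.injective Subtype.val_injective), h,
    Set.ncard_coe_finset, Finset.card_filter]
  push_cast
  exact Finset.sum_congr rfl fun e _ => by simp [edgeIndicator, Set.indicator]

/-! ### The Bernoulli divergence -/

lemma bernoulliKL_eq (p q : unitInterval) (h0 : 0 < (q : ℝ)) (h1 : (q : ℝ) < 1) :
    bernoulliKL p q = p * Real.log (p / q) + (1 - p) * Real.log ((1 - p) / (1 - q)) := by
  have hq1 : 0 < 1 - (q : ℝ) := by linarith
  have r : ∀ r : unitInterval, (bernoulliMeasure true false r {true}).toReal = r ∧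
      (bernoulliMeasure true false r {false}).toReal = 1 - r := by
    intro r
    refine ⟨?_, ?_⟩
    · exact bernoulliMeasure_real_apply_of_mem_of_notMem r (by simp) (by simp) (by simp)
    · exact bernoulliMeasure_real_apply_of_notMem_of_mem r (by simp) (by simp) (by simp)
  have hpos : ∀ b : Bool, bernoulliMeasure true false q {b} ≠ 0 := by
    intro b hb
    have := r q
    cases b <;> simp [hb] at this <;> linarith
  have hac : bernoulliMeasure true false p ≪ bernoulliMeasure true false q := by
    intro s hs
    have : s = ∅ := by
      by_contra hne
      obtain ⟨b, hb⟩ := Set.nonempty_iff_ne_empty.2 hne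
      exact hpos b (measure_mono_null (Set.singleton_subset_iff.2 hb) hs)
    simp [this]
  have hrn : ∀ b : Bool, ((bernoulliMeasure true false p).rnDeriv
      (bernoulliMeasure true false q) b).toReal * (bernoulliMeasure true false q {b}).toReal
      = (bernoulliMeasure true false p {b}).toReal := by
    intro b
    rw [← ENNReal.toReal_mul, ← lintegral_singleton, Measure.setLIntegral_rnDeriv hac]
  rw [bernoulliKL, InformationTheory.toReal_klDiv_of_measure_eq hac (by simp),
    integral_bernoulliMeasure]
  simp only [llr, smul_eq_mul]
  have ht := hrn true
  have hf := hrn false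
  rw [(r p).1, (r q).1] at ht
  rw [(r p).2, (r q).2] at hf
  rw [eq_div_of_mul_eq h0.ne' ht, eq_div_of_mul_eq hq1.ne' hf]

/-- One term of the comparison of relative entropy with the squared Hellinger distance. -/
lemma two_mul_sub_sqrt_le_mul_log {x y : ℝ} (hx : 0 ≤ x) (hy : 0 < y) :
    2 * x - 2 * √x * √y ≤ x * Real.log (x / y) := by
  rcases hx.eq_or_lt with rfl | hx
  · simp
  have hsx := Real.sqrt_pos.2 hx
  have hsy := Real.sqrt_pos.2 hy
  have h := Real.log_le_sub_one_of_pos (div_pos hsy hsx)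
  have e : Real.log (x / y) = -2 * Real.log (√y / √x) := by
    rw [Real.log_div hx.ne' hy.ne', Real.log_div hsy.ne' hsx.ne', Real.log_sqrt hx.le,
      Real.log_sqrt hy.le]
    ring
  have e2 : x * (√y / √x) = √x * √y := by
    nth_rw 1 [← Real.mul_self_sqrt hx.le]
    field_simp
  rw [e]
  nlinarith

/-- A weak form of Pinsker's inequality, through the Hellinger distance. -/
lemma sq_sub_le_four_mul_bernoulliKL (p q : unitInterval) (h0 : 0 < (q : ℝ)) (h1 : (q : ℝ) < 1) :
    ((p : ℝ) - q) ^ 2 ≤ 4 * bernoulliKL p q := by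
  rw [bernoulliKL_eq p q h0 h1]
  have hp0 : (0 : ℝ) ≤ p := p.2.1
  have hp1 : (p : ℝ) ≤ 1 := p.2.2
  have a := two_mul_sub_sqrt_le_mul_log hp0 h0
  have b := two_mul_sub_sqrt_le_mul_log (sub_nonneg.2 hp1) (sub_pos.2 h1)
  have e1 := Real.sq_sqrt hp0
  have e2 := Real.sq_sqrt h0.le
  have e3 := Real.sq_sqrt (sub_nonneg.2 hp1)
  have e4 := Real.sq_sqrt (sub_pos.2 h1).le
  have hs : (√(p : ℝ) + √(q : ℝ)) ^ 2 ≤ 4 := by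
    have := Real.sqrt_le_one.2 hp1
    have := Real.sqrt_le_one.2 h1.le
    have := Real.sqrt_nonneg (p : ℝ)
    have := Real.sqrt_nonneg (q : ℝ)
    nlinarith
  have key : ((p : ℝ) - q) ^ 2 ≤ 4 * (√(p : ℝ) - √(q : ℝ)) ^ 2 := by
    have : ((p : ℝ) - q) = (√(p : ℝ) - √(q : ℝ)) * (√(p : ℝ) + √(q : ℝ)) := by
      nlinarith
    rw [this, mul_pow]
    nlinarith [sq_nonneg (√(p : ℝ) - √(q : ℝ))]
  nlinarith [sq_nonneg (√(1 - (p : ℝ)) - √(1 - (q : ℝ)))]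

/-! ### The upper tail -/

/-- Chernoff's bound for the number of edges of `G(V, q)` among a set `T` of pairs. -/
lemma edgeCount_chernoff {V : Type*} [Finite V] (p q : unitInterval) (h0 : 0 < (q : ℝ))
    (hqp : (q : ℝ) ≤ p) (hp : (p : ℝ) < 1) (T : Finset (Sym2 V)) (hT : ∀ e ∈ T, ¬ e.IsDiag) :
    (SimpleGraph.binomialRandom V q).real
      {G | (p : ℝ) * T.card ≤ ∑ e ∈ T, edgeIndicator e G} ≤
      Real.exp (-(T.card * bernoulliKL p q)) := by
  obtain ⟨hind, hint⟩ := edgeIndicator_iIndepFun_and_integral (V := V) q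
  have hq1 : 0 < 1 - (q : ℝ) := by linarith
  have hp1 : 0 < 1 - (p : ℝ) := by linarith
  have hp0 : 0 < (p : ℝ) := by linarith
  -- the optimal exponential tilt, which turns parameter `q` into parameter `p`
  set t := Real.log (p / q) - Real.log ((1 - p) / (1 - q)) with ht
  have ht0 : 0 ≤ t := by
    have a : 0 ≤ Real.log ((p : ℝ) / q) := Real.log_nonneg ((one_le_div h0).2 hqp)
    have b : Real.log ((1 - (p : ℝ)) / (1 - q)) ≤ 0 :=
      Real.log_nonpos (by positivity) ((div_le_one hq1).2 (by linarith))
    linarith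
  have het : Real.exp t = (p / q) * ((1 - q) / (1 - p)) := by
    rw [ht, Real.exp_sub, Real.exp_log (by positivity), Real.exp_log (by positivity)]
    field_simp
  have hmgf : mgf (∑ e ∈ T, edgeIndicator e) (SimpleGraph.binomialRandom V q) t
      = ((1 - q) / (1 - p)) ^ T.card := by
    rw [hind.mgf_sum (fun e => measurable_edgeIndicator e), Finset.prod_eq_pow_card]
    intro e he
    rw [mgf, hint e (hT e he) (fun x => Real.exp (t * x))]
    simp only [mul_one, mul_zero, Real.exp_zero, het]
    field_simp
    ring
  have := measure_ge_le_exp_mul_mgf (μ := SimpleGraph.binomialRandom V q)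
    (X := ∑ e ∈ T, edgeIndicator e) ((p : ℝ) * T.card) ht0 Integrable.of_finite
  rw [hmgf] at this
  simp only [Finset.sum_apply] at this
  refine this.trans_eq ?_
  rw [← Real.exp_log (show 0 < (1 - (q : ℝ)) / (1 - p) by positivity), ← Real.exp_nat_mul,
    ← Real.exp_add, bernoulliKL_eq p q h0 (by linarith), ht]
  congr 1
  rw [← inv_div (1 - (p : ℝ)) (1 - q), Real.log_inv]
  ring

lemma densestSubgraphVal_le_of_forall {V : Type*} [Fintype V] {k : ℕ} (hk : 2 ≤ k) {c : ℝ}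
    (hc : 0 ≤ c) {G : SimpleGraph V}
    (h : ∀ S : Finset V, S.card = k → ∑ e ∈ edgesWithin S, edgeIndicator e G ≤ c * k.choose 2) :
    densestSubgraphVal k G ≤ c := by
  refine Real.iSup_le (fun S => ?_) hc
  have hN : (0 : ℝ) < k.choose 2 := by exact_mod_cast Nat.choose_pos hk
  rw [subgraphDensity, ncard_edgeSet_induce, S.2, div_le_iff₀ hN]
  exact h S.1 S.2

lemma le_densestSubgraphVal_of_le {V : Type*} [Fintype V] {k : ℕ} (hk : 2 ≤ k) {c : ℝ}
    {G : SimpleGraph V} (S : Finset V) (hS : S.card = k)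
    (h : c * k.choose 2 ≤ ∑ e ∈ edgesWithin S, edgeIndicator e G) :
    c ≤ densestSubgraphVal k G := by
  have hN : (0 : ℝ) < k.choose 2 := by exact_mod_cast Nat.choose_pos hk
  refine le_trans ?_ (le_ciSup (f := fun S : {S : Finset V // S.card = k} =>
    subgraphDensity G S.1) (Set.finite_range _).bddAbove ⟨S, hS⟩)
  rw [subgraphDensity, ncard_edgeSet_induce, hS, le_div_iff₀ hN]
  exact h

/-- Union bound over all `k`-element vertex sets. -/
lemma measure_lt_densestSubgraphVal_le {n k : ℕ} (hk : 2 ≤ k) (p q : unitInterval)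
    (h0 : 0 < (q : ℝ)) (hqp : (q : ℝ) ≤ p) :
    (SimpleGraph.binomialRandom (Fin n) q).real {G | (p : ℝ) < densestSubgraphVal k G} ≤
      (n : ℝ) ^ k * Real.exp (-(k.choose 2 * bernoulliKL p q)) := by
  rcases p.2.2.eq_or_lt with hp1 | hp1
  · have : {G : SimpleGraph (Fin n) | (p : ℝ) < densestSubgraphVal k G} = ∅ := by
      refine Set.eq_empty_iff_forall_notMem.2 fun G hG => not_le.2 (Set.mem_ofPred_eq ▸ hG) ?_
      refine densestSubgraphVal_le_of_forall hk p.2.1 fun S hS => ?_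
      refine (Finset.sum_le_card_nsmul _ _ 1 fun e _ => edgeIndicator_le_one e G).trans ?_
      rw [card_edgesWithin, hS, hp1]
      simp
    rw [this, measureReal_empty]
    positivity
  let B : Finset (Fin n) → Set (SimpleGraph (Fin n)) := fun S =>
    {G | (p : ℝ) * (edgesWithin S).card ≤ ∑ e ∈ edgesWithin S, edgeIndicator e G}
  have hsub : {G : SimpleGraph (Fin n) | (p : ℝ) < densestSubgraphVal k G} ⊆
      ⋃ S ∈ Finset.powersetCard k (Finset.univ : Finset (Fin n)), B S := by
    intro G hG
    by_contra hcon
    refine not_le.2 hG (densestSubgraphVal_le_of_forall hk p.2.1 fun S hS => ?_)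
    by_contra hlt
    refine hcon (Set.mem_biUnion (x := S)
      (by simpa using hS) ?_)
    simp only [B, Set.mem_ofPred_eq, card_edgesWithin, hS]
    exact (not_le.1 hlt).le
  calc _ ≤ (SimpleGraph.binomialRandom (Fin n) q).real
        (⋃ S ∈ Finset.powersetCard k (Finset.univ : Finset (Fin n)), B S) :=
          measureReal_mono hsub (measure_ne_top _ _)
    _ ≤ ∑ S ∈ Finset.powersetCard k (Finset.univ : Finset (Fin n)),
        (SimpleGraph.binomialRandom (Fin n) q).real (B S) := measureReal_biUnion_finset_le _ _
    _ ≤ ∑ S ∈ Finset.powersetCard k (Finset.univ : Finset (Fin n)),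
        Real.exp (-(k.choose 2 * bernoulliKL p q)) := by
          refine Finset.sum_le_sum fun S hS => ?_
          have := edgeCount_chernoff p q h0 hqp hp1 (edgesWithin S)
            fun e he => not_isDiag_of_mem_edgesWithin he
          rw [card_edgesWithin, (Finset.mem_powersetCard.1 hS).2] at this
          simpa only [B, card_edgesWithin, (Finset.mem_powersetCard.1 hS).2] using this
    _ ≤ _ := by
          rw [Finset.sum_const, Finset.card_powersetCard, nsmul_eq_mul, Finset.card_univ,
            Fintype.card_fin]
          gcongr
          exact_mod_cast Nat.choose_le_pow n k

/-! ### Sums of independent bounded variables -/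

lemma measurable_partialSums {ι : Type*} [DecidableEq ι] {γ : Type*} [Fintype γ]
    (E : γ → Finset ι) :
    Measurable fun (x : {i // i ∈ Finset.univ.biUnion E} → ℝ) (c : γ) =>
      ∑ i : {i // i ∈ Finset.univ.biUnion E}, if i.1 ∈ E c then x i else 0 := by
  refine measurable_pi_lambda _ fun c => Finset.measurable_sum _ fun i _ => ?_
  split_ifs
  · exact measurable_pi_apply i
  · exact measurable_const

lemma partialSums_eq {ι : Type*} [DecidableEq ι] {γ : Type*} [Fintype γ] (E : γ → Finset ι)
    (f : ι → ℝ) (c : γ) :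
    (∑ i : {i // i ∈ Finset.univ.biUnion E}, if i.1 ∈ E c then f i else 0) = ∑ i ∈ E c, f i := by
  rw [Finset.sum_coe_sort (Finset.univ.biUnion E) (fun i => if i ∈ E c then f i else 0),
    Finset.sum_ite_mem,
    Finset.inter_eq_right.2 (Finset.subset_biUnion_of_mem E (Finset.mem_univ c))]

/-- Two families of partial sums of independent variables are independent of each other as soon as
every index set of the first is disjoint from every index set of the second. -/
lemma indepFun_sums_of_disjoint {Ω ι : Type*} [MeasurableSpace Ω] [DiscreteMeasurableSpace Ω]
    {μ : Measure Ω} {W : ι → Ω → ℝ} (hW : iIndepFun W μ) {α β : Type*}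
    [Fintype α] [Fintype β] {C : α → Finset ι} {D : β → Finset ι}
    (h : ∀ a b, Disjoint (C a) (D b)) :
    IndepFun (fun ω a => ∑ i ∈ C a, W i ω) (fun ω b => ∑ i ∈ D b, W i ω) μ := by
  classical
  have hd : Disjoint (Finset.univ.biUnion C) (Finset.univ.biUnion D) := by
    simp only [Finset.disjoint_biUnion_left, Finset.disjoint_biUnion_right]
    exact fun a _ b _ => h b a
  have key := (hW.indepFun_finset _ _ hd fun i => Measurable.of_discrete).comp
    (measurable_partialSums C) (measurable_partialSums D)
  exact key.congr (.of_forall fun ω => funext (partialSums_eq C fun i => W i ω))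
    (.of_forall fun ω => funext (partialSums_eq D fun i => W i ω))

section Moments

variable {Ω ι : Type*} [MeasurableSpace Ω] [DiscreteMeasurableSpace Ω] [Finite Ω]
  {μ : Measure Ω} [IsProbabilityMeasure μ] {W : ι → Ω → ℝ}

/-- First, second and fourth moments of a sum of independent centred variables bounded by `1`. -/
lemma moments_sum_of_iIndepFun (hW : iIndepFun W μ) {v : ℝ} (hv : v ≤ 1) (T : Finset ι)
    (hb : ∀ i ∈ T, ∀ ω, |W i ω| ≤ 1) (h1 : ∀ i ∈ T, ∫ ω, W i ω ∂μ = 0)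
    (h2 : ∀ i ∈ T, ∫ ω, W i ω ^ 2 ∂μ = v) :
    ∫ ω, ∑ i ∈ T, W i ω ∂μ = 0 ∧ ∫ ω, (∑ i ∈ T, W i ω) ^ 2 ∂μ = T.card * v ∧
      ∫ ω, (∑ i ∈ T, W i ω) ^ 4 ∂μ ≤ 4 * T.card ^ 2 := by
  classical
  induction T using Finset.induction_on with
  | empty => simp
  | insert i T hi ih =>
    obtain ⟨e1, e2, e4⟩ := ih (fun j hj => hb j (Finset.mem_insert_of_mem hj))
      (fun j hj => h1 j (Finset.mem_insert_of_mem hj))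
      (fun j hj => h2 j (Finset.mem_insert_of_mem hj))
    have hi1 := h1 i (Finset.mem_insert_self i T)
    have hi2 := h2 i (Finset.mem_insert_self i T)
    have hib := hb i (Finset.mem_insert_self i T)
    have hind : IndepFun (fun ω => ∑ j ∈ T, W j ω) (W i) μ := by
      have := hW.indepFun_finsetSum_of_notMem (fun j => Measurable.of_discrete) hi
      simpa only [Finset.sum_apply, Finset.sum_fn] using this
    set Y : Ω → ℝ := fun ω => ∑ j ∈ T, W j ω with hY
    have hmix : ∀ a b : ℕ, ∫ ω, Y ω ^ a * W i ω ^ b ∂μ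
        = (∫ ω, Y ω ^ a ∂μ) * ∫ ω, W i ω ^ b ∂μ := by
      intro a b
      have := hind.comp (φ := fun x : ℝ => x ^ a) (ψ := fun x : ℝ => x ^ b)
        (by fun_prop) (by fun_prop)
      exact this.integral_fun_mul_eq_mul_integral
        (Measurable.of_discrete).aestronglyMeasurable (Measurable.of_discrete).aestronglyMeasurable
    have I : ∀ f : Ω → ℝ, Integrable f μ := fun f => Integrable.of_finite
    have hw4 : ∫ ω, W i ω ^ 4 ∂μ ≤ 1 := by
      have : ∫ ω, W i ω ^ 4 ∂μ ≤ ∫ _, (1 : ℝ) ∂μ := by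
        refine integral_mono (I _) (I _) fun ω => ?_
        have : W i ω ^ 4 = |W i ω| ^ 4 := (Even.pow_abs (by decide) _).symm
        simp only [this]
        exact pow_le_one₀ (abs_nonneg _) (hib ω)
      simpa using this
    have f11 := hmix 1 1
    have f13 := hmix 1 3
    have f22 := hmix 2 2
    have f31 := hmix 3 1
    simp only [pow_one] at f11 f13 f31
    simp only [Finset.sum_insert hi, Finset.card_insert_of_notMem hi]
    change ∫ ω, W i ω + Y ω ∂μ = 0 ∧ ∫ ω, (W i ω + Y ω) ^ 2 ∂μ = _ ∧
      ∫ ω, (W i ω + Y ω) ^ 4 ∂μ ≤ _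
    refine ⟨?_, ?_, ?_⟩
    · rw [integral_add (I _) (I _), hi1, e1, add_zero]
    · have : ∀ ω, (W i ω + Y ω) ^ 2 = W i ω ^ 2 + (2 * (Y ω * W i ω) + Y ω ^ 2) :=
        fun ω => by ring
      simp_rw [this]
      rw [integral_add (I _) (I _), integral_add (I _) (I _), integral_const_mul, f11, hi1, hi2, e2]
      push_cast
      ring
    · have : ∀ ω, (W i ω + Y ω) ^ 4 = W i ω ^ 4 + (4 * (Y ω * W i ω ^ 3)
          + (6 * (Y ω ^ 2 * W i ω ^ 2) + (4 * (Y ω ^ 3 * W i ω) + Y ω ^ 4))) :=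
        fun ω => by ring
      simp_rw [this]
      rw [integral_add (I _) (I _), integral_add (I _) (I _), integral_add (I _) (I _),
        integral_add (I _) (I _), integral_const_mul, integral_const_mul, integral_const_mul,
        f13, f22, f31, hi1, hi2, e2, e1]
      have hv0 : 0 ≤ v := by rw [← hi2]; exact integral_nonneg fun ω => sq_nonneg _
      have hc : (0 : ℝ) ≤ T.card := by positivity
      push_cast
      nlinarith [mul_nonneg hc (sub_nonneg.2 hv), mul_le_one₀ hv hv0 hv,
        mul_nonneg hc (sub_nonneg.2 (mul_le_one₀ hv hv0 hv))]

/-- A Khinchine-type lower bound, obtained by comparing `|y|` with `l y² - l³ y⁴`. -/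
lemma sqrt_card_le_integral_abs_sum (hW : iIndepFun W μ) {v : ℝ} (hv : v ≤ 1) (T : Finset ι)
    (hb : ∀ i ∈ T, ∀ ω, |W i ω| ≤ 1) (h1 : ∀ i ∈ T, ∫ ω, W i ω ∂μ = 0)
    (h2 : ∀ i ∈ T, ∫ ω, W i ω ^ 2 ∂μ = v) :
    v ^ 2 / 8 * √T.card ≤ ∫ ω, |∑ i ∈ T, W i ω| ∂μ := by
  obtain ⟨-, e2, e4⟩ := moments_sum_of_iIndepFun hW hv T hb h1 h2
  rcases T.eq_empty_or_nonempty with rfl | ⟨i, hi⟩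
  · simp
  have hv0 : 0 ≤ v := by rw [← h2 i hi]; exact integral_nonneg fun ω => sq_nonneg _
  have hc : (0 : ℝ) < T.card := by exact_mod_cast Finset.card_pos.2 ⟨i, hi⟩
  have hs : 0 < √(T.card : ℝ) := Real.sqrt_pos.2 hc
  have hss : √(T.card : ℝ) ^ 2 = T.card := Real.sq_sqrt hc.le
  set s := √(T.card : ℝ)
  -- with `l` of order `1 / √(card T)` the terms `l E Y²` and `l³ E Y⁴` are both of order `√(card T)`;
  -- the factor `v / 4` makes the first dominate
  set l := v / (4 * s) with hl
  have hl0 : 0 ≤ l := by positivity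
  have I : ∀ f : Ω → ℝ, Integrable f μ := fun f => Integrable.of_finite
  have hpt : ∀ y : ℝ, l * y ^ 2 - l ^ 3 * y ^ 4 ≤ |y| := by
    intro y
    rcases hl0.eq_or_lt with h | hl0
    · simp [← h]
    have hx : ∀ x : ℝ, 0 ≤ x → x ^ 2 - x ^ 4 ≤ x := by
      intro x hx
      rcases le_total x 1 with h | h
      · nlinarith [pow_nonneg hx 4]
      · nlinarith [pow_le_pow_right₀ h (show 2 ≤ 4 by norm_num)]
    have := hx (l * |y|) (by positivity)
    have ey2 : |y| ^ 2 = y ^ 2 := sq_abs y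
    have ey4 : |y| ^ 4 = y ^ 4 := Even.pow_abs (by decide) y
    rw [mul_pow, mul_pow, ey2, ey4] at this
    have : l * (l * y ^ 2 - l ^ 3 * y ^ 4) ≤ l * |y| := by linarith
    exact le_of_mul_le_mul_left this hl0
  have h := integral_mono (μ := μ) (I _) (I _) fun ω => hpt (∑ i ∈ T, W i ω)
  rw [integral_sub (I _) (I _), integral_const_mul, integral_const_mul, e2] at h
  refine le_trans ?_ h
  have : l ^ 3 * ∫ ω, (∑ i ∈ T, W i ω) ^ 4 ∂μ ≤ l ^ 3 * (4 * T.card ^ 2) := by gcongr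
  have e : l * (T.card * v) - l ^ 3 * (4 * T.card ^ 2) = v ^ 2 / 4 * s - v ^ 3 / 16 * s := by
    rw [hl, ← hss]
    field_simp
    ring
  have : v ^ 3 * s ≤ v ^ 2 * s := by
    have : v ^ 3 ≤ v ^ 2 := by nlinarith [sq_nonneg v]
    gcongr
  nlinarith [mul_nonneg (sq_nonneg v) hs.le]

/-- Chebyshev's inequality with the variance replaced by an upper bound. -/
lemma chebyshev_real {X : Ω → ℝ} {t B : ℝ} (ht : 0 < t) (hB : variance X μ ≤ B) :
    μ.real {ω | t ≤ |X ω - ∫ ω, X ω ∂μ|} ≤ B / t ^ 2 := by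
  have h := meas_ge_le_variance_div_sq (μ := μ) (X := X)
    (MemLp.of_discrete) ht
  have h0 : 0 ≤ variance X μ / t ^ 2 := div_nonneg (variance_nonneg _ _) (sq_nonneg _)
  refine (ENNReal.toReal_le_of_le_ofReal h0 h).trans ?_
  gcongr

lemma measureReal_le_abs_sum_le (hW : iIndepFun W μ) {v : ℝ} (hv : v ≤ 1) (T : Finset ι)
    (hb : ∀ i ∈ T, ∀ ω, |W i ω| ≤ 1) (h1 : ∀ i ∈ T, ∫ ω, W i ω ∂μ = 0)
    (h2 : ∀ i ∈ T, ∫ ω, W i ω ^ 2 ∂μ = v) {t B : ℝ} (ht : 0 < t) (hB : T.card ≤ B) :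
    μ.real {ω | t ≤ |∑ i ∈ T, W i ω|} ≤ B / t ^ 2 := by
  obtain ⟨e1, e2, -⟩ := moments_sum_of_iIndepFun hW hv T hb h1 h2
  have := chebyshev_real (μ := μ) (X := fun ω => ∑ i ∈ T, W i ω) (B := B) ht ?_
  · simpa only [e1, sub_zero] using this
  · rw [variance_of_integral_eq_zero Measurable.of_discrete.aemeasurable e1, e2]
    refine le_trans ?_ hB
    exact mul_le_of_le_one_right (by positivity) hv

/-- Choosing, for each `j`, the larger of two partial sums over `a` independent variables gains an
amount of order `√a` per choice, because `max x y = (x + y) / 2 + |x - y| / 2`. The remaining index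
set `R s` depends on the choices `s`, but is disjoint from the indices which determine them;
conditionally on the choices its contribution is still centred, with variance at most `B`. -/
lemma exists_selection (hW : iIndepFun W μ) {v : ℝ} (hv : v ≤ 1) {U : Set ι}
    (hb : ∀ i ω, |W i ω| ≤ 1) (h1 : ∀ i ∈ U, ∫ ω, W i ω ∂μ = 0)
    (h2 : ∀ i ∈ U, ∫ ω, W i ω ^ 2 ∂μ = v)
    {J : Type*} [Fintype J] [DecidableEq J] {C : J → Bool → Finset ι}
    {R : (J → Bool) → Finset ι} {a : ℕ} {B t : ℝ} (ht : 0 < t)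
    (hCU : ∀ j x, ∀ i ∈ C j x, i ∈ U) (hRU : ∀ s, ∀ i ∈ R s, i ∈ U)
    (hCC : ∀ j x j' x', (j, x) ≠ (j', x') → Disjoint (C j x) (C j' x'))
    (hCR : ∀ j x s, Disjoint (C j x) (R s)) (hCa : ∀ j x, (C j x).card = a)
    (hRB : ∀ s, (R s).card ≤ B) (hJB : 2 * a * (Fintype.card J : ℝ) ≤ B) :
    μ.real {ω | ∀ s : J → Bool, ∑ j, ∑ i ∈ C j (s j), W i ω + ∑ i ∈ R s, W i ω
        < Fintype.card J * (v ^ 2 / 16 * √(2 * a)) - 2 * t} ≤ 3 * B / t ^ 2 := by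
  classical
  have I : ∀ f : Ω → ℝ, Integrable f μ := fun f => Integrable.of_finite
  set Z : J → Bool → Ω → ℝ := fun j x ω => ∑ i ∈ C j x, W i ω with hZ
  set Y : J → Ω → ℝ := fun j ω => |Z j true ω - Z j false ω| with hY
  -- `D j` is the set of all indices used by the choice `j`
  set D : J → Finset ι := fun j => C j true ∪ C j false with hD
  have hdis : ∀ j, Disjoint (C j true) (C j false) := fun j => hCC _ _ _ _ (by simp)
  have hDcard : ∀ j, (D j).card = 2 * a := fun j => by
    rw [hD, Finset.card_union_of_disjoint (hdis j), hCa, hCa]; ring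
  have hDU : ∀ j, ∀ i ∈ D j, i ∈ U := fun j i hi => by
    rcases Finset.mem_union.1 hi with h | h <;> exact hCU _ _ _ h
  have hsigned : ∀ j, v ^ 2 / 8 * √(2 * a) ≤ ∫ ω, Y j ω ∂μ ∧ variance (Y j) μ ≤ 2 * a := by
    intro j
    -- with the signs `ε`, the difference of the two partial sums is a single sum over `D j`
    let ε : ι → ℝ := fun i => if i ∈ C j true then 1 else -1
    have hε : ∀ i, ε i = 1 ∨ ε i = -1 := fun i => by
      by_cases h : i ∈ C j true <;> simp [ε, h]
    have hind : iIndepFun (fun i ω => ε i * W i ω) μ :=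
      hW.comp (fun i x => ε i * x) fun i => by fun_prop
    have hb' : ∀ i ∈ D j, ∀ ω, |ε i * W i ω| ≤ 1 := fun i _ ω => by
      rcases hε i with h | h <;> simpa [h] using hb i ω
    have h1' : ∀ i ∈ D j, ∫ ω, ε i * W i ω ∂μ = 0 := fun i hi => by
      rw [integral_const_mul, h1 i (hDU j i hi), mul_zero]
    have h2' : ∀ i ∈ D j, ∫ ω, (ε i * W i ω) ^ 2 ∂μ = v := fun i hi => by
      rcases hε i with h | h <;> simpa [h] using h2 i (hDU j i hi)
    have e : ∀ ω, ∑ i ∈ D j, ε i * W i ω = Z j true ω - Z j false ω := by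
      intro ω
      rw [hD, Finset.sum_union (hdis j), sub_eq_add_neg, hZ, ← Finset.sum_neg_distrib]
      congr 1
      · exact Finset.sum_congr rfl fun i hi => by simp [ε, hi]
      · refine Finset.sum_congr rfl fun i hi => ?_
        have : i ∉ C j true := fun h => Finset.disjoint_left.1 (hdis j) h hi
        simp [ε, this]
    have k1 := sqrt_card_le_integral_abs_sum hind hv (D j) hb' h1' h2'
    obtain ⟨-, k2, -⟩ := moments_sum_of_iIndepFun hind hv (D j) hb' h1' h2'
    simp only [e, hDcard] at k1 k2
    push_cast at k1 k2
    refine ⟨k1, (variance_le_expectation_sq Measurable.of_discrete.aestronglyMeasurable).trans ?_⟩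
    have : ∫ ω, (Y j ^ 2) ω ∂μ = 2 * a * v := by
      rw [← k2]; simp [hY]
    rw [this]
    exact mul_le_of_le_one_right (by positivity) hv
  have hcard : (0 : ℝ) ≤ Fintype.card J := by positivity
  -- the deviation of the sum of the gains
  have hE1 : μ.real {ω | t ≤ |∑ j, Y j ω - ∫ ω, ∑ j, Y j ω ∂μ|} ≤ B / t ^ 2 := by
    refine chebyshev_real ht (le_trans ?_ hJB)
    have hvar := IndepFun.variance_sum (μ := μ) (X := Y) (s := Finset.univ)
      (fun j _ => MemLp.of_discrete) ?_
    · have e : (fun ω => ∑ j, Y j ω) = ∑ j, Y j := by ext ω; simp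
      rw [e, hvar]
      refine (Finset.sum_le_card_nsmul _ _ _ fun j _ => (hsigned j).2).trans_eq ?_
      simp [mul_comm]
    · intro j _ j' _ hjj
      have := (indepFun_sums_of_disjoint hW (C := C j) (D := C j')
        fun x x' => hCC _ _ _ _ (by simp [hjj])).comp
        (φ := fun z : Bool → ℝ => |z true - z false|) (ψ := fun z : Bool → ℝ => |z true - z false|)
        (by fun_prop) (by fun_prop)
      exact this
  -- the sum over all the indices of all the choices
  have hE2 : μ.real {ω | t ≤ |∑ i ∈ Finset.univ.biUnion D, W i ω|} ≤ B / t ^ 2 := by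
    refine measureReal_le_abs_sum_le hW hv _ (fun i _ => hb i) ?_ ?_ ht ?_
    · intro i hi
      obtain ⟨j, -, hj⟩ := Finset.mem_biUnion.1 hi
      exact h1 i (hDU j i hj)
    · intro i hi
      obtain ⟨j, -, hj⟩ := Finset.mem_biUnion.1 hi
      exact h2 i (hDU j i hj)
    · refine le_trans ?_ hJB
      have := Finset.card_biUnion_le_card_mul Finset.univ D (2 * a) fun j _ => (hDcard j).le
      rw [Finset.card_univ] at this
      calc ((Finset.univ.biUnion D).card : ℝ) ≤ ((Fintype.card J * (2 * a) : ℕ) : ℝ) := by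
            exact_mod_cast this
        _ = _ := by push_cast; ring
  have hsumD : ∀ ω, ∑ i ∈ Finset.univ.biUnion D, W i ω = ∑ j, (Z j true ω + Z j false ω) := by
    intro ω
    rw [Finset.sum_biUnion]
    · exact Finset.sum_congr rfl fun j _ => by rw [hD, Finset.sum_union (hdis j)]
    · intro j _ j' _ hjj
      simp only [Function.onFun, hD, Finset.disjoint_union_left, Finset.disjoint_union_right]
      refine ⟨⟨?_, ?_⟩, ?_, ?_⟩ <;> exact hCC _ _ _ _ (by simp [hjj])
  -- the best choices
  let sel : Ω → J → Bool := fun ω j => decide (Z j false ω ≤ Z j true ω)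
  have hsel : ∀ ω j, Z j (sel ω j) ω = (Z j true ω + Z j false ω) / 2 + Y j ω / 2 := by
    intro ω j
    by_cases h : Z j false ω ≤ Z j true ω
    · simp only [sel, h, decide_true, hY, abs_of_nonneg (sub_nonneg.2 h)]; ring
    · simp only [sel, h, decide_false, hY, abs_of_nonpos (sub_nonpos.2 (not_le.1 h).le)]; ring
  have hE3 : μ.real {ω | t ≤ |∑ i ∈ R (sel ω), W i ω|} ≤ B / t ^ 2 := by
    have hsub : {ω | t ≤ |∑ i ∈ R (sel ω), W i ω|} ⊆ ⋃ s ∈ (Finset.univ : Finset (J → Bool)),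
        ({ω | sel ω = s} ∩ {ω | t ≤ |∑ i ∈ R s, W i ω|}) := by
      intro ω hω
      exact Set.mem_biUnion (Finset.mem_coe.2 (Finset.mem_univ (sel ω))) ⟨rfl, hω⟩
    have hprod : ∀ s, μ.real ({ω | sel ω = s} ∩ {ω | t ≤ |∑ i ∈ R s, W i ω|})
        = μ.real {ω | sel ω = s} * μ.real {ω | t ≤ |∑ i ∈ R s, W i ω|} := by
      intro s
      have hi := indepFun_sums_of_disjoint hW (C := fun x : J × Bool => C x.1 x.2)
        (D := fun _ : Unit => R s) fun x _ => hCR _ _ _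
      have hA : MeasurableSet {z : J × Bool → ℝ |
          ∀ j, decide (z (j, false) ≤ z (j, true)) = s j} := by
        have : {z : J × Bool → ℝ | ∀ j, decide (z (j, false) ≤ z (j, true)) = s j}
            = ⋂ j, {z | decide (z (j, false) ≤ z (j, true)) = s j} := by ext; simp
        rw [this]
        refine MeasurableSet.iInter fun j => ?_
        have hm : MeasurableSet {z : J × Bool → ℝ | z (j, false) ≤ z (j, true)} :=
          measurableSet_le (measurable_pi_apply _) (measurable_pi_apply _)
        cases s j
        · convert hm.compl using 1
          ext; simp
        · simpa using hm
      have hB : MeasurableSet {z : Unit → ℝ | t ≤ |z ()|} :=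
        measurableSet_le measurable_const (by fun_prop)
      have := hi.measure_inter_preimage_eq_mul _ _ hA hB
      rw [measureReal_def, measureReal_def, measureReal_def, ← ENNReal.toReal_mul]
      congr 1
      convert this using 2
      · congr 1
        ext ω
        exact funext_iff
      · congr 1
        ext ω
        exact funext_iff
      · rfl
    have htot : ∑ s, μ.real {ω | sel ω = s} = 1 := by
      have := measureReal_biUnion_finset (μ := μ) (s := (Finset.univ : Finset (J → Bool)))
        (f := fun s => {ω | sel ω = s})
        (fun s _ s' _ h => Set.disjoint_left.2 fun ω h1 h2 => h (h1.symm.trans h2))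
        (fun s _ => MeasurableSet.of_discrete)
      rw [← this]
      convert probReal_univ (μ := μ)
      ext ω; simp
    calc _ ≤ _ := measureReal_mono hsub (measure_ne_top _ _)
      _ ≤ ∑ s, μ.real ({ω | sel ω = s} ∩ {ω | t ≤ |∑ i ∈ R s, W i ω|}) :=
          measureReal_biUnion_finset_le _ _
      _ ≤ ∑ s, μ.real {ω | sel ω = s} * (B / t ^ 2) := by
          refine Finset.sum_le_sum fun s _ => ?_
          rw [hprod]
          gcongr
          exact measureReal_le_abs_sum_le hW hv _ (fun i _ => hb i)
            (fun i hi => h1 i (hRU s i hi)) (fun i hi => h2 i (hRU s i hi)) ht (hRB s)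
      _ = B / t ^ 2 := by rw [← Finset.sum_mul, htot, one_mul]
  have hmean : Fintype.card J * (v ^ 2 / 8 * √(2 * a)) ≤ ∫ ω, ∑ j, Y j ω ∂μ := by
    rw [integral_finsetSum _ fun j _ => I _]
    have := Finset.card_nsmul_le_sum Finset.univ (fun j => ∫ ω, Y j ω ∂μ) _
      fun j _ => (hsigned j).1
    simpa using this
  have hsub : {ω | ∀ s : J → Bool, ∑ j, ∑ i ∈ C j (s j), W i ω + ∑ i ∈ R s, W i ω
        < Fintype.card J * (v ^ 2 / 16 * √(2 * a)) - 2 * t} ⊆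
      {ω | t ≤ |∑ j, Y j ω - ∫ ω, ∑ j, Y j ω ∂μ|} ∪
      ({ω | t ≤ |∑ i ∈ Finset.univ.biUnion D, W i ω|} ∪
      {ω | t ≤ |∑ i ∈ R (sel ω), W i ω|}) := by
    intro ω hω
    by_contra hcon
    simp only [Set.mem_union, Set.mem_ofPred_eq, not_or, not_le] at hcon
    obtain ⟨c1, c2, c3⟩ := hcon
    have hω := hω (sel ω)
    have e : ∑ j, ∑ i ∈ C j (sel ω j), W i ω
        = (∑ i ∈ Finset.univ.biUnion D, W i ω) / 2 + (∑ j, Y j ω) / 2 := by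
      rw [hsumD, Finset.sum_div, Finset.sum_div, ← Finset.sum_add_distrib]
      exact Finset.sum_congr rfl fun j _ => hsel ω j
    rw [e] at hω
    have := (abs_lt.1 c1).1
    have := (abs_lt.1 c2).1
    have := (abs_lt.1 c3).1
    linarith
  calc _ ≤ _ := measureReal_mono hsub (measure_ne_top _ _)
    _ ≤ _ := (measureReal_union_le _ _).trans
        (add_le_add hE1 ((measureReal_union_le _ _).trans (add_le_add hE2 hE3)))
    _ = 3 * B / t ^ 2 := by ring

end Moments

/-! ### Dense subgraphs exist -/

open Classical in
/-- The pairs joining the vertex `v` to the elements of `A`. -/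
noncomputable def edgesBetween {V : Type*} (A : Finset V) (v : V) : Finset (Sym2 V) :=
  A.image fun x => s(x, v)

lemma mem_edgesBetween {V : Type*} {A : Finset V} {v : V} {e : Sym2 V} :
    e ∈ edgesBetween A v ↔ ∃ x ∈ A, s(x, v) = e := by
  classical
  simp [edgesBetween]

lemma card_edgesBetween {V : Type*} (A : Finset V) (v : V) :
    (edgesBetween A v).card = A.card := by
  classical
  exact Finset.card_image_of_injective _ fun x y h => Sym2.congr_left.1 h

lemma disjoint_edgesBetween {V : Type*} {A : Finset V} {v w : V} (hw : w ∉ A)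
    (h : v ≠ w) : Disjoint (edgesBetween A v) (edgesBetween A w) := by
  refine Finset.disjoint_left.2 fun e he he' => ?_
  obtain ⟨x, hx, rfl⟩ := mem_edgesBetween.1 he
  obtain ⟨y, hy, e⟩ := mem_edgesBetween.1 he'
  rcases Sym2.eq_iff.1 e with ⟨-, h2⟩ | ⟨-, h2⟩
  · exact h h2.symm
  · exact hw (h2 ▸ hx)

lemma disjoint_edgesBetween_edgesWithin {V : Type*} [DecidableEq V] {A B : Finset V} {v : V}
    (hv : v ∉ A) (hAB : Disjoint A B) :
    Disjoint (edgesBetween A v) (edgesWithin A ∪ edgesWithin B) := by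
  refine Finset.disjoint_left.2 fun e he he' => ?_
  obtain ⟨x, hx, rfl⟩ := mem_edgesBetween.1 he
  rcases Finset.mem_union.1 he' with h | h
  · exact hv (mk_mem_edgesWithin.1 h).2.1
  · exact Finset.disjoint_left.1 hAB hx (mk_mem_edgesWithin.1 h).1

lemma not_isDiag_of_mem_edgesBetween {V : Type*} {A : Finset V} {v : V} (hv : v ∉ A)
    {e : Sym2 V} (he : e ∈ edgesBetween A v) : ¬ e.IsDiag := by
  obtain ⟨x, hx, rfl⟩ := mem_edgesBetween.1 he
  exact fun h => hv (Sym2.mk_isDiag_iff.1 h ▸ hx)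

lemma edgesWithin_union {V : Type*} [DecidableEq V] {A B : Finset V} (hAB : Disjoint A B) :
    edgesWithin (A ∪ B) = B.biUnion (edgesBetween A) ∪ (edgesWithin A ∪ edgesWithin B) := by
  ext e
  induction e using Sym2.ind with
  | _ x y =>
    have hd : ∀ z, z ∈ A → z ∉ B := fun z hz => Finset.disjoint_left.1 hAB hz
    simp only [mk_mem_edgesWithin, Finset.mem_union, Finset.mem_biUnion, mem_edgesBetween,
      Sym2.eq_iff]
    constructor
    · rintro ⟨hx | hx, hy | hy, hne⟩
      · exact .inr (.inl ⟨hx, hy, hne⟩)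
      · exact .inl ⟨y, hy, x, hx, .inl ⟨rfl, rfl⟩⟩
      · exact .inl ⟨x, hx, y, hy, .inr ⟨rfl, rfl⟩⟩
      · exact .inr (.inr ⟨hx, hy, hne⟩)
    · rintro (⟨w, hw, z, hz, ⟨rfl, rfl⟩ | ⟨rfl, rfl⟩⟩ | ⟨h1, h2, h3⟩ | ⟨h1, h2, h3⟩)
      · exact ⟨.inl hz, .inr hw, fun h => hd _ hz (h ▸ hw)⟩
      · exact ⟨.inr hw, .inl hz, fun h => hd _ hz (h ▸ hw)⟩
      · exact ⟨.inl h1, .inl h2, h3⟩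
      · exact ⟨.inr h1, .inr h2, h3⟩

lemma sum_edgesWithin_union {V : Type*} [DecidableEq V] {A B : Finset V} (hAB : Disjoint A B)
    (f : Sym2 V → ℝ) :
    ∑ e ∈ edgesWithin (A ∪ B), f e = ∑ v ∈ B, ∑ e ∈ edgesBetween A v, f e
      + ∑ e ∈ edgesWithin A ∪ edgesWithin B, f e := by
  have hB : ∀ v ∈ B, v ∉ A := fun v hv hA => Finset.disjoint_left.1 hAB hA hv
  rw [edgesWithin_union hAB, Finset.sum_union, Finset.sum_biUnion]
  · exact fun v hv w hw h => disjoint_edgesBetween (hB w hw) h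
  · exact (Finset.disjoint_biUnion_left _ _ _).2 fun v hv =>
      disjoint_edgesBetween_edgesWithin (hB v hv) hAB

/-- A dense `k`-vertex subgraph exists: fix `k / 2` vertices, and from each of `k - k / 2` disjoint
pairs of further vertices take the one with the more neighbours among the fixed ones. -/
lemma measure_densestSubgraphVal_lt_le {n k : ℕ} (hk : 2 ≤ k) (hkn : 2 * k ≤ n)
    (p q : unitInterval) (h0 : 0 < (q : ℝ)) (h1 : (q : ℝ) < 1) {v t : ℝ} (hv : v = q * (1 - q))
    (ht : 0 < t) (hp : ((p : ℝ) - q) * k.choose 2 ≤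
      (k - k / 2 : ℕ) * (v ^ 2 / 16 * √(2 * (k / 2 : ℕ))) - 2 * t) :
    (SimpleGraph.binomialRandom (Fin n) q).real {G | densestSubgraphVal k G < p} ≤
      3 * (k : ℝ) ^ 2 / t ^ 2 := by
  classical
  obtain ⟨hind, hint⟩ := edgeIndicator_iIndepFun_and_integral (V := Fin n) q
  set a := k / 2 with ha
  set b := k - a with hb
  have hab : a + b = k := by omega
  obtain ⟨φ⟩ : Nonempty (Fin a ⊕ (Fin b × Bool) ↪ Fin n) :=
    Function.Embedding.nonempty_of_card_le (by simp; omega)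
  let A : Finset (Fin n) := Finset.univ.image fun i => φ (.inl i)
  let u : Fin b → Bool → Fin n := fun j x => φ (.inr (j, x))
  let S : (Fin b → Bool) → Finset (Fin n) := fun s => Finset.univ.image fun j => u j (s j)
  have hu : ∀ j x, u j x ∉ A := by
    intro j x h
    obtain ⟨i, -, hi⟩ := Finset.mem_image.1 h
    simpa using φ.injective hi
  have huinj : ∀ j x j' x', (j, x) ≠ (j', x') → u j x ≠ u j' x' := fun j x j' x' h e =>
    h (Sum.inr_injective (φ.injective e))
  have hsinj : ∀ s : Fin b → Bool, Function.Injective fun j => u j (s j) := fun s j j' e => by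
    by_contra h
    exact huinj j (s j) j' (s j') (by simp [h]) e
  have hAcard : A.card = a := by
    exact (Finset.card_image_of_injective _ (φ.injective.comp Sum.inl_injective)).trans (by simp)
  have hScard : ∀ s, (S s).card = b := fun s => by
    rw [Finset.card_image_of_injective _ (hsinj s)]; simp
  have hAS : ∀ s, Disjoint A (S s) := fun s => by
    refine Finset.disjoint_right.2 fun x hx => ?_
    obtain ⟨j, -, rfl⟩ := Finset.mem_image.1 hx
    exact hu _ _
  have hk2 : (a : ℝ) + b = k := by exact_mod_cast hab
  have hsq : ∀ m : ℕ, (m.choose 2 : ℝ) ≤ (m : ℝ) ^ 2 := fun m => by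
    exact_mod_cast Nat.choose_le_pow m 2
  have hWind : iIndepFun (fun e (G : SimpleGraph (Fin n)) => edgeIndicator e G - (q : ℝ))
      (SimpleGraph.binomialRandom (Fin n) q) :=
    hind.comp (fun e x => x - (q : ℝ)) fun e => by fun_prop
  have key := exists_selection hWind (v := v) (by rw [hv]; nlinarith) (U := {e | ¬ e.IsDiag})
    (fun e G => by
      have := edgeIndicator_nonneg e G
      have := edgeIndicator_le_one e G
      rw [abs_le]; constructor <;> linarith)
    (fun e he => by rw [hint e he fun x => x - (q : ℝ)]; ring)
    (fun e he => by rw [hint e he fun x => (x - (q : ℝ)) ^ 2, hv]; ring)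
    (C := fun j x => edgesBetween A (u j x))
    (R := fun s => edgesWithin A ∪ edgesWithin (S s)) (a := a) (B := (k : ℝ) ^ 2) ht
    (fun j x e he => not_isDiag_of_mem_edgesBetween (hu j x) he)
    (fun s e he => (Finset.mem_union.1 he).elim not_isDiag_of_mem_edgesWithin
      not_isDiag_of_mem_edgesWithin)
    (fun j x j' x' h => disjoint_edgesBetween (hu _ _) (huinj _ _ _ _ h))
    (fun j x s => disjoint_edgesBetween_edgesWithin (hu _ _) (hAS s))
    (fun j x => by rw [card_edgesBetween, hAcard])
    (fun s => by
      have := Finset.card_union_le (edgesWithin A) (edgesWithin (S s))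
      rw [card_edgesWithin, card_edgesWithin, hAcard, hScard] at this
      have : ((edgesWithin A ∪ edgesWithin (S s)).card : ℝ) ≤ a.choose 2 + b.choose 2 := by
        exact_mod_cast this
      have := hsq a
      have := hsq b
      rw [← hk2]
      nlinarith [mul_nonneg (Nat.cast_nonneg (α := ℝ) a) (Nat.cast_nonneg (α := ℝ) b)])
    (by
      rw [Fintype.card_fin, ← hk2]
      nlinarith [sq_nonneg (a : ℝ), sq_nonneg (b : ℝ)])
  refine le_trans (measureReal_mono ?_ (measure_ne_top _ _)) key
  intro G hG s
  have hcard : (A ∪ S s).card = k := by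
    rw [Finset.card_union_of_disjoint (hAS s), hAcard, hScard, hab]
  have hlt : ∑ e ∈ edgesWithin (A ∪ S s), edgeIndicator e G < p * k.choose 2 := by
    by_contra h
    exact not_le.2 (show densestSubgraphVal k G < p from hG)
      (le_densestSubgraphVal_of_le hk _ hcard (not_lt.1 h))
  have hsum := sum_edgesWithin_union (hAS s) fun e => edgeIndicator e G - (q : ℝ)
  rw [Finset.sum_image fun j _ j' _ h => hsinj s h] at hsum
  rw [← hsum, Finset.sum_sub_distrib, Finset.sum_const, card_edgesWithin, hcard, nsmul_eq_mul,
    Fintype.card_fin]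
  linarith

/-- In terms of the divergence: the gain `v² k √k / 64` beats `(p - q) * k.choose 2`, which by the
weak Pinsker inequality is at most `ε⁴ k √k / 128`, and leaves room for deviations of the same
order. -/
lemma measure_densestSubgraphVal_lt_le_div {n k : ℕ} (hk : 2 ≤ k) (hkn : 2 * k ≤ n)
    (p q : unitInterval) {ε : ℝ} (hε : 0 < ε) (h0 : ε ≤ q) (h1 : (q : ℝ) ≤ 1 - ε)
    (hKL : k * bernoulliKL p q ≤ (ε ^ 4 / 128) ^ 2) :
    (SimpleGraph.binomialRandom (Fin n) q).real {G | densestSubgraphVal k G < p} ≤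
      3 * (256 / ε ^ 4) ^ 2 / k := by
  have hq0 : 0 < (q : ℝ) := by linarith
  have hq1 : (q : ℝ) < 1 := by linarith
  have hk2 : (2 : ℝ) ≤ k := by exact_mod_cast hk
  have hk0 : (0 : ℝ) < k := by linarith
  have hs0 : 0 < √(k : ℝ) := Real.sqrt_pos.2 hk0
  have hss : √(k : ℝ) ^ 2 = k := Real.sq_sqrt hk0.le
  set s := √(k : ℝ)
  set v : ℝ := q * (1 - q) with hv
  have hvε : ε ^ 4 ≤ v ^ 2 := by
    have : ε ^ 2 ≤ v := by rw [hv, sq]; exact mul_le_mul h0 (by linarith) hε.le hq0.le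
    calc ε ^ 4 = (ε ^ 2) ^ 2 := by ring
      _ ≤ v ^ 2 := by gcongr
  have hdiff : ((p : ℝ) - q) * s ≤ ε ^ 4 / 64 := by
    refine abs_le_of_sq_le_sq' ?_ (by positivity) |>.2
    have := sq_sub_le_four_mul_bernoulliKL p q hq0 hq1
    calc (((p : ℝ) - q) * s) ^ 2 = k * ((p : ℝ) - q) ^ 2 := by rw [mul_pow, hss]; ring
      _ ≤ k * (4 * bernoulliKL p q) := by gcongr
      _ ≤ (ε ^ 4 / 64) ^ 2 := by linarith
  have ht : 0 < ε ^ 4 * (k * s) / 256 := by positivity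
  refine (measure_densestSubgraphVal_lt_le hk hkn p q hq0 hq1 hv ht ?_).trans_eq ?_
  · have hb : (k : ℝ) / 2 ≤ (k - k / 2 : ℕ) := by
      have : k ≤ 2 * (k - k / 2) := by omega
      have : (k : ℝ) ≤ 2 * (k - k / 2 : ℕ) := by exact_mod_cast this
      linarith
    have ha : s / 2 ≤ √(2 * (k / 2 : ℕ)) := by
      refine Real.le_sqrt_of_sq_le ?_
      have : k ≤ 2 * (k / 2) + 1 := by omega
      have : (k : ℝ) ≤ 2 * (k / 2 : ℕ) + 1 := by exact_mod_cast this
      rw [div_pow, hss]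
      linarith
    have h1 : (k : ℝ) / 2 * (ε ^ 4 / 16 * (s / 2)) ≤
        (k - k / 2 : ℕ) * (v ^ 2 / 16 * √(2 * (k / 2 : ℕ))) := by gcongr
    have h2 : ((p : ℝ) - q) * k.choose 2 ≤ ε ^ 4 / 128 * (k * s) := by
      rw [Nat.cast_choose_two]
      have : ((p : ℝ) - q) * s * (s * (k - 1) / 2 * s) ≤ ε ^ 4 / 64 * (s * (k - 1) / 2 * s) := by
        have : (0 : ℝ) ≤ k - 1 := by linarith
        gcongr
      have e : ((p : ℝ) - q) * s * (s * (k - 1) / 2 * s) =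
          ((p : ℝ) - q) * (k * (k - 1) / 2) * s := by
        rw [← hss]; ring
      have e2 : ε ^ 4 / 64 * (s * (k - 1) / 2 * s) = ε ^ 4 / 128 * (k * (k - 1)) := by
        rw [← hss]; ring
      rw [e, e2] at this
      refine le_of_mul_le_mul_right (this.trans ?_) hs0
      have e3 : ε ^ 4 / 128 * (k * s) * s = ε ^ 4 / 128 * (k * k) := by
        rw [← hss]; ring
      rw [e3]
      gcongr
      linarith
    linarith
  · rw [div_pow, div_pow, mul_pow, mul_pow, hss]
    field_simp

/-! ### Asymptotics -/

lemma tendsto_measure_one_of_compl {Ω : ℕ → Type*} [∀ n, MeasurableSpace (Ω n)]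
    [∀ n, DiscreteMeasurableSpace (Ω n)] {μ : ∀ n, Measure (Ω n)}
    [∀ n, IsProbabilityMeasure (μ n)] {A : ∀ n, Set (Ω n)} {r : ℕ → ℝ}
    (hr : Tendsto r atTop (𝓝 0)) (h : ∀ᶠ n in atTop, (μ n).real (A n)ᶜ ≤ r n) :
    Tendsto (fun n => μ n (A n)) atTop (𝓝 1) := by
  have h1 : Tendsto (fun n => (μ n).real (A n)) atTop (𝓝 1) := by
    have hl : Tendsto (fun n => 1 - r n) atTop (𝓝 1) := by
      simpa using (tendsto_const_nhds (x := (1 : ℝ))).sub hr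
    refine tendsto_of_tendsto_of_tendsto_of_le_of_le' hl tendsto_const_nhds ?_
      (.of_forall fun n => measureReal_le_one)
    filter_upwards [h] with n hn
    rw [probReal_compl_eq_one_sub MeasurableSet.of_discrete] at hn
    linarith
  have h2 := ENNReal.tendsto_ofReal h1
  simpa [measureReal_def] using h2

lemma tendsto_natCast_atTop_of_isTildeBigOmega {γ : ℝ} (hγ : 0 < γ) {k : ℕ → ℕ}
    (hk : IsTildeBigOmega (fun n => (k n : ℝ)) (fun n => (n : ℝ) ^ γ)) :
    Tendsto (fun n => (k n : ℝ)) atTop atTop := by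
  obtain ⟨c, hc⟩ := hk
  have hlog : (fun x : ℝ => Real.log x ^ (-c)) =o[atTop] fun x => x ^ (γ / 2) :=
    isLittleO_log_rpow_rpow_atTop _ (by positivity)
  have hlog' := hlog.comp_tendsto (tendsto_natCast_atTop_atTop (R := ℝ))
  have h1 : (fun n : ℕ => (n : ℝ) ^ (γ / 2)) =O[atTop]
      fun n : ℕ => (n : ℝ) ^ γ * Real.log n ^ c := by
    refine IsBigO.of_bound 1 ?_
    filter_upwards [hlog'.bound (show (0 : ℝ) < 1 by norm_num), eventually_gt_atTop 1]
      with n hn hn1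
    have hn1' : (1 : ℝ) < n := by exact_mod_cast hn1
    have hn0 : (0 : ℝ) < n := by linarith
    have hl : 0 < Real.log n := Real.log_pos hn1'
    simp only [Function.comp, one_mul, Real.norm_eq_abs] at hn ⊢
    rw [abs_of_pos (by positivity), abs_of_pos (by positivity)] at hn ⊢
    rw [Real.rpow_neg hl.le, inv_le_iff_one_le_mul₀ (by positivity)] at hn
    calc (n : ℝ) ^ (γ / 2) ≤ (n : ℝ) ^ (γ / 2) * ((n : ℝ) ^ (γ / 2) * Real.log n ^ c) :=
          le_mul_of_one_le_right (by positivity) hn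
      _ = _ := by rw [← mul_assoc, ← Real.rpow_add hn0, add_halves]
  have h2 := h1.trans hc
  have h3 : Tendsto (fun n : ℕ => (n : ℝ) ^ (γ / 2)) atTop atTop :=
    (tendsto_rpow_atTop (by positivity)).comp tendsto_natCast_atTop_atTop
  have h4 := tendsto_norm_atTop_atTop.comp h3
  obtain ⟨C, hC0, hC⟩ := h2.exists_pos
  have h5 : Tendsto (fun n : ℕ => C⁻¹ * ‖(n : ℝ) ^ (γ / 2)‖) atTop atTop :=
    h4.const_mul_atTop (by positivity)
  refine tendsto_atTop_mono' _ ?_ h5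
  filter_upwards [hC.bound] with n hn
  rw [inv_mul_le_iff₀ hC0]
  simpa using hn

lemma isLittleO_natCast_of_isTildeO {γ : ℝ} (hγ : γ < 1) {k : ℕ → ℕ}
    (hk : IsTildeO (fun n => (k n : ℝ)) (fun n => (n : ℝ) ^ γ)) :
    (fun n => (k n : ℝ)) =o[atTop] fun n => (n : ℝ) := by
  obtain ⟨c, hc⟩ := hk
  refine hc.trans_isLittleO ?_
  have hlog : (fun x : ℝ => Real.log x ^ c) =o[atTop] fun x => x ^ (1 - γ) :=
    isLittleO_log_rpow_rpow_atTop _ (by linarith)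
  have h := (isBigO_refl (fun n : ℕ => (n : ℝ) ^ γ) atTop).mul_isLittleO
    (hlog.comp_tendsto (tendsto_natCast_atTop_atTop (R := ℝ)))
  refine h.congr' .rfl ?_
  filter_upwards [eventually_gt_atTop 0] with n hn
  have hn0 : (0 : ℝ) < n := by exact_mod_cast hn
  simp only [Function.comp]
  rw [← Real.rpow_add hn0, add_sub_cancel, Real.rpow_one]

theorem theorem4p3 (γ : ℝ) (hγ : γ ∈ Set.Ioo (1 / 2 : ℝ) 1)
    (k : ℕ → ℕ) (hk : IsTildeTheta (fun n => (k n : ℝ)) (fun n => (n : ℝ) ^ γ))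
    (p₀ : ℕ → unitInterval)
    (hp₀ : ∃ ε : ℝ, 0 < ε ∧ ∀ᶠ n in atTop, ε ≤ (p₀ n : ℝ) ∧ (p₀ n : ℝ) ≤ 1 - ε)
    (p : ℕ → unitInterval) :
    ((∀ᶠ n in atTop, p₀ n ≤ p n) →
      IsTildeLittleOmega (fun n => (k n : ℝ) * bernoulliKL (p n) (p₀ n)) (fun _ => 1) →
      Tendsto (fun n => (SimpleGraph.binomialRandom (Fin n) (p₀ n))
        {G | densestSubgraphVal (k n) G ≤ (p n : ℝ)}) atTop (𝓝 1)) ∧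
    (IsTildeLittleO (fun n => (k n : ℝ) * bernoulliKL (p n) (p₀ n)) (fun _ => 1) →
      Tendsto (fun n => (SimpleGraph.binomialRandom (Fin n) (p₀ n))
        {G | (p n : ℝ) ≤ densestSubgraphVal (k n) G}) atTop (𝓝 1)) := by
  obtain ⟨ε, hε, hp₀⟩ := hp₀
  have hkinf := tendsto_natCast_atTop_of_isTildeBigOmega (by linarith [hγ.1]) hk.2
  have hk2 : ∀ᶠ n in atTop, 2 ≤ k n := by
    filter_upwards [hkinf.eventually_ge_atTop 2] with n hn
    exact_mod_cast hn
  have hnn : ∀ n, 0 ≤ (k n : ℝ) * bernoulliKL (p n) (p₀ n) := fun n =>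
    mul_nonneg (Nat.cast_nonneg _) ENNReal.toReal_nonneg
  constructor
  · intro hpp hω
    have hr : Tendsto (fun n => Real.exp (-(k n : ℝ))) atTop (𝓝 0) :=
      Real.tendsto_exp_neg_atTop_nhds_zero.comp hkinf
    refine tendsto_measure_one_of_compl hr ?_
    filter_upwards [hp₀, hpp, hk2, (hω 1).bound (show (0 : ℝ) < 1 / 8 by norm_num),
      eventually_ge_atTop 3] with n h1 h2 h3 h4 h5
    have hset : {G : SimpleGraph (Fin n) | densestSubgraphVal (k n) G ≤ (p n : ℝ)}ᶜ
        = {G | (p n : ℝ) < densestSubgraphVal (k n) G} := by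
      ext G; simp
    rw [hset]
    refine (measure_lt_densestSubgraphVal_le h3 (p n) (p₀ n) (by linarith) h2).trans ?_
    have hn0 : (0 : ℝ) < n := by positivity
    have hlog : 1 ≤ Real.log n := by
      rw [Real.le_log_iff_exp_le hn0]
      have : (3 : ℝ) ≤ n := by exact_mod_cast h5
      linarith [Real.exp_one_lt_d9]
    rw [Real.norm_of_nonneg (hnn n), one_mul, Real.rpow_one, Real.norm_of_nonneg (by linarith)]
      at h4
    have hk2' : (2 : ℝ) ≤ k n := by exact_mod_cast h3
    rw [← Real.exp_log hn0, ← Real.exp_nat_mul, ← Real.exp_add, Real.exp_le_exp,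
      Nat.cast_choose_two]
    have hkl : 0 ≤ bernoulliKL (p n) (p₀ n) := ENNReal.toReal_nonneg
    -- `k - 1 ≥ k / 2` and `k · KL ≥ 8 log n`, so the exponent is at most `- k log n ≤ - k`
    have e1 : (k n : ℝ) * (2 * Real.log n) ≤
        (k n : ℝ) * ((k n - 1) / 2 * bernoulliKL (p n) (p₀ n)) := by
      refine mul_le_mul_of_nonneg_left ?_ (Nat.cast_nonneg _)
      nlinarith
    nlinarith
  · intro ho
    have hr : Tendsto (fun n => 3 * (256 / ε ^ 4) ^ 2 / (k n : ℝ)) atTop (𝓝 0) :=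
      tendsto_const_nhds.div_atTop hkinf
    refine tendsto_measure_one_of_compl hr ?_
    have hδ : 0 < (ε ^ 4 / 128) ^ 2 := by positivity
    filter_upwards [hp₀, hk2, (ho 0).bound hδ,
      (isLittleO_natCast_of_isTildeO hγ.2 hk.1).bound (show (0 : ℝ) < 1 / 2 by norm_num)]
      with n h1 h2 h3 h4
    have hset : {G : SimpleGraph (Fin n) | (p n : ℝ) ≤ densestSubgraphVal (k n) G}ᶜ
        = {G | densestSubgraphVal (k n) G < (p n : ℝ)} := by
      ext G; simp
    rw [hset]
    refine measure_densestSubgraphVal_lt_le_div h2 ?_ (p n) (p₀ n) hε h1.1 h1.2 ?_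
    · simp only [Real.norm_natCast] at h4
      have : 2 * (k n : ℝ) ≤ n := by linarith
      exact_mod_cast this
    · simpa [abs_of_nonneg (hnn n), Real.norm_eq_abs] using (le_abs_self _).trans h3
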